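/- **Setting.** For a function $f:\mathbb N\to\mathbb R$ say that $f$ is negligible if $\lim_{t\to\infty} t^c f(t)=0$ for every $c\in\mathbb N$. For $n,m\ge 1$ identify $\mathbb F_{2^n}$ with $\mathbb F_2^n$ by an $\mathbb F_2$-linear isomorphism $\sigma$, and write $\mathrm{hw}(\mathbf z)$ for the number of nonzero coordinates of $\mathbf z\in\mathbb F_{2^n}^m$. For $f:\mathbb F_{2^n}^m\to\mathbb C$ let $$\hat f(\mathbf z)=2^{-nm/2}\sum_{\mathbf y\in\mathbb F_{2^n}^m} f(\mathbf y)\,(-1)^{\mathrm{Tr}(\mathbf z\cdot\mathbf y)},$$ where $\mathrm{Tr}:\mathbb F_{2^n}\to\mathbb F_2$ is the absolute trace. *Code and decoder.* Given distinct $\gamma_1,\dots,\gamma_m\in\mathbb F_{2^n}$ and $k\in\mathbb N$, let $C^\perp=\{(f(\gamma_1),\dots,f(\gamma_m)) : f\in\mathbb F_{2^n}[X],\ \deg f<k\}$ be the Reed–Solomon code and let $C$ be its dual code. For $\mathbf z\in\mathbb F_{2^n}^m$, let $L(\mathbf z)=\{\mathbf x\in C^\perp:\mathrm{hw}(\mathbf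 x-\mathbf z)\le m-\sqrt{km}\}$ be the output of list decoding; $\mathsf{Decode}(\mathbf z)$ is the unique $\mathbf x\in L(\mathbf z)$ with $\mathrm{hw}(\mathbf z-\mathbf x)\le(\frac12+\varepsilon)m$ if there is exactly one such $\mathbf x$, and $\mathbf 0$ otherwise. Put $$\mathcal B=\{\mathbf e\in\mathbb F_{2^n}^m:\exists\,\mathbf x\in C^\perp,\ \mathsf{Decode}(\mathbf x+\mathbf e)\ne\mathbf x\},\qquad \mathcal G=\mathbb F_{2^n}^m\setminus\mathcal B,$$ $$\mathsf{BAD}=(\mathbb F_{2^n}^m\times\mathbb F_{2^n}^m)\setminus(C^\perp\times\mathcal G).$$ *Amplitudes.* Let $V(\mathbf x)=|C|^{-1/2}$ for $\mathbf x\in C$ and $V(\mathbf x)=0$ otherwise. For $\mathcal P=(p_1,\dots,p_m)$ with $p_i\in\mathbb F_2[X_{i,1},\dots,X_{i,n}]$, let $R$ be the set of $\mathbf e=(\mathbf e_1,\dots,\mathbf e_m)\in\mathbb F_{2^n}^m$ with $p_i(\sigma(\mathbf e_i))=0$ for all $i$, and let $W^{\mathcal P}(\mathbf e)=|R|^{-1/2}$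 for $\mathbf e\in R$ and $W^{\mathcal P}(\mathbf e)=0$ otherwise. *Distributions.* A probability distribution $\mathscr P$ on $\mathbb F_2[X_1,\dots,X_n]$ is shift-invariant if, for $p\sim\mathscr P$, the polynomial $p(X+\mathbf s)$ has distribution $\mathscr P$ for every $\mathbf s\in\mathbb F_2^n$; it is 2-wise independent if $\Pr_{p\sim\mathscr P}[p(\mathbf x)=a\wedge p(\mathbf y)=b]=\frac14$ for all $\mathbf x\ne\mathbf y$ in $\mathbb F_2^n$ and all $a,b\in\mathbb F_2$. **Lemma.** Let $\varepsilon\in(0,\frac16)$ and $\alpha$ be constants with $\frac78+\frac34\varepsilon<\alpha<1$. Let $n=n(\lambda)$, $m=m(\lambda)$, $k=k(\lambda)$ be natural numbers with $n=\Theta(\lambda)$, $m=\omega(\log n)$ and $|k-(1-\alpha)m|<1$ (that is, $k$ is $(1-\alpha)m$, rounded up or down if it is not an integer). Then there are negligible functions $\mu:\mathbb N\to[0,1]$ and $\nu:\mathbb N\to\mathbb R$ such that for all sufficiently large $\lambda$ the following holds for all distinct $\gamma_1,\dots,\gamma_m\in\mathbb F_{2^n}$ (so that $C^\perp$ is a Reed–Solomon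 code of length $m$ with parameter $k$ over $\mathbb F_{2^n}$), every $\mathbb F_2$-linear identification $\sigma:\mathbb F_{2^n}\cong\mathbb F_2^n$, and all shift-invariant and 2-wise independent distributions $\mathscr P_1,\dots,\mathscr P_m$ with $\mathscr P_i$ on $\mathbb F_2[X_{i,1},\dots,X_{i,n}]$. For every $\mathcal P$, $$\sum_{(\mathbf x,\mathbf e)\in\mathsf{BAD}}\bigl|\hat V(\mathbf x)\,\hat W^{\mathcal P}(\mathbf e)\bigr|^2=\sum_{\mathbf e\in\mathcal B}\bigl|\hat W^{\mathcal P}(\mathbf e)\bigr|^2,$$ and with probability at least $1-\nu(n)$ over $\mathcal P=(p_1,\dots,p_m)$ with independent $p_i\sim\mathscr P_i$, $$\sum_{\mathbf e\in\mathcal B}\bigl|\hat W^{\mathcal P}(\mathbf e)\bigr|^2\le\mu(\lambda).$$ -/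

import Mathlib

open Filter Asymptotics MeasureTheory
open scoped Classical Matrix ENNReal

noncomputable section

namespace PolySystem

/-- A function `f : ℕ → ℝ` is negligible if `n ^ c * f n → 0` for every `c : ℕ`. -/
def Negligible (f : ℕ → ℝ) : Prop :=
  SuperpolynomialDecay atTop (fun n : ℕ => (n : ℝ)) f

/-! ### Fourier transform over a finite field of characteristic two -/

instance instFintypeGaloisField (n : ℕ) : Fintype (GaloisField 2 n) := Fintype.ofFinite _

section Fourier

variable {F : Type*} [Field F] [Fintype F] [Algebra (ZMod 2) F] {m : ℕ}

/-- The sign `(-1) ^ Tr(a)`, where `Tr` is the absolute trace `F → 𝔽₂`. -/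
def traceSign (a : F) : ℂ := (-1) ^ (Algebra.trace (ZMod 2) F a).val

/-- `f̂(z) = q ^ (-m/2) * ∑ y, f(y) (-1) ^ Tr(z ⬝ y)` on `F ^ m`, with `q = |F|`. -/
def fourier (f : (Fin m → F) → ℂ) (z : Fin m → F) : ℂ :=
  (1 / (Real.sqrt ((Fintype.card F : ℝ) ^ m) : ℂ)) * ∑ y, f y * traceSign (z ⬝ᵥ y)

end Fourier

/-! ### Reed-Solomon codes, dual codes, the decoder -/

section Codes

variable {F : Type*} [Field F] {m : ℕ}

/-- The Reed-Solomon code: evaluations at the points `γ 1, …, γ m` of the polynomials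
`a_0 + a_1 X + ⋯ + a_(k-1) X ^ (k-1)`. -/
def reedSolomon (γ : Fin m ↪ F) (k : ℕ) : Submodule F (Fin m → F) :=
  (Polynomial.degreeLT F k).map
    (LinearMap.pi fun i => (Polynomial.leval (γ i) : Polynomial F →ₗ[F] F))

theorem mem_reedSolomon (γ : Fin m ↪ F) (k : ℕ) (x : Fin m → F) :
    x ∈ reedSolomon γ k ↔
      ∃ f : Polynomial F, f.degree < k ∧ ∀ i, x i = f.eval (γ i) := by
  simp only [reedSolomon, Submodule.mem_map, Polynomial.mem_degreeLT]
  constructor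
  · rintro ⟨f, hf, rfl⟩
    exact ⟨f, hf, fun i => rfl⟩
  · rintro ⟨f, hf, h⟩
    exact ⟨f, hf, funext fun i => (h i).symm⟩

/-- The dual code `{z | ∀ x ∈ C, x ⬝ z = 0}`. -/
def dualCode (C : Submodule F (Fin m → F)) : Submodule F (Fin m → F) where
  carrier := {z | ∀ x ∈ C, x ⬝ᵥ z = 0}
  add_mem' := fun ha hb x hx => by rw [dotProduct_add, ha x hx, hb x hx, add_zero]
  zero_mem' := fun x _ => dotProduct_zero x
  smul_mem' := fun c z hz x hx => by rw [dotProduct_smul, hz x hx, smul_zero]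

variable [Fintype F]

/-- The output of Reed-Solomon list decoding: all codewords `x` whose Hamming distance to `z`
is at most `m - √(k m)`. -/
def rsListDecode (γ : Fin m ↪ F) (k : ℕ) (z : Fin m → F) : Finset (Fin m → F) :=
  Finset.univ.filter fun x =>
    x ∈ reedSolomon γ k ∧ (hammingNorm (x - z) : ℝ) ≤ m - Real.sqrt ((k : ℝ) * m)

/-- The decoder: list-decode `z`; if exactly one `x` in the list satisfies
`hw(z - x) ≤ (1/2 + ε) m`, output it, otherwise output `0`. -/
def decode (γ : Fin m ↪ F) (k : ℕ) (ε : ℝ) (z : Fin m → F) : Fin m → F :=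
  if h : ∃! x, x ∈ rsListDecode γ k z ∧ (hammingNorm (z - x) : ℝ) ≤ (1 / 2 + ε) * m
  then h.choose else 0

/-- The set `𝒢` of errors that the decoder corrects for every codeword. -/
def goodErrors (γ : Fin m ↪ F) (k : ℕ) (ε : ℝ) : Set (Fin m → F) :=
  {e | ∀ x ∈ reedSolomon γ k, decode γ k ε (x + e) = x}

/-- The set `ℬ` of errors on which the decoder fails for some codeword. -/
def badErrors (γ : Fin m ↪ F) (k : ℕ) (ε : ℝ) : Set (Fin m → F) :=
  {e | ∃ x ∈ reedSolomon γ k, decode γ k ε (x + e) ≠ x}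

/-- The set `BAD`, the complement of `GOOD = (Reed-Solomon code) × 𝒢`. -/
def badPairs (γ : Fin m ↪ F) (k : ℕ) (ε : ℝ) : Set ((Fin m → F) × (Fin m → F)) :=
  ((reedSolomon γ k : Set (Fin m → F)) ×ˢ goodErrors γ k ε)ᶜ

end Codes

/-! ### Amplitudes -/

section Amplitudes

variable {F : Type*} [Field F] [Fintype F] {m n : ℕ}

/-- The amplitude function `V` of the uniform superposition over the code `C`. -/
def codeAmplitude (C : Submodule F (Fin m → F)) (x : Fin m → F) : ℂ :=
  if x ∈ C then 1 / (Real.sqrt (Nat.card C) : ℂ) else 0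

variable [Algebra (ZMod 2) F]

/-- The root set `R = R_1 × ⋯ × R_m` as a subset of `F ^ m`; an element of `F` is read as a vector
of `𝔽₂ ^ n` through `σ`. -/
def rootSet (σ : F ≃ₗ[ZMod 2] (Fin n → ZMod 2)) (p : Fin m → MvPolynomial (Fin n) (ZMod 2)) :
    Finset (Fin m → F) :=
  Finset.univ.filter fun e => ∀ i, MvPolynomial.eval (σ (e i)) (p i) = 0

/-- The amplitude function `W` of the uniform superposition over the root set (zero if there is
no root). -/
def rootAmplitude (σ : F ≃ₗ[ZMod 2] (Fin n → ZMod 2))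
    (p : Fin m → MvPolynomial (Fin n) (ZMod 2)) (e : Fin m → F) : ℂ :=
  if e ∈ rootSet σ p then 1 / (Real.sqrt (rootSet σ p).card : ℂ) else 0

/-- `∑ |V̂(x) Ŵ(e)|²` over `(x, e) ∈ BAD`, where `V` is the amplitude function of the dual of the
Reed-Solomon code. -/
def badStateMass (γ : Fin m ↪ F) (k : ℕ) (ε : ℝ) (σ : F ≃ₗ[ZMod 2] (Fin n → ZMod 2))
    (p : Fin m → MvPolynomial (Fin n) (ZMod 2)) : ℝ :=
  ∑ xe : (Fin m → F) × (Fin m → F) with xe ∈ badPairs γ k ε,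
    ‖fourier (codeAmplitude (dualCode (reedSolomon γ k))) xe.1 *
      fourier (rootAmplitude σ p) xe.2‖ ^ 2

/-- `∑ |Ŵ(e)|²` over `e ∈ ℬ`. -/
def badErrorMass (γ : Fin m ↪ F) (k : ℕ) (ε : ℝ) (σ : F ≃ₗ[ZMod 2] (Fin n → ZMod 2))
    (p : Fin m → MvPolynomial (Fin n) (ZMod 2)) : ℝ :=
  ∑ e : Fin m → F with e ∈ badErrors γ k ε, ‖fourier (rootAmplitude σ p) e‖ ^ 2

end Amplitudes

/-! ### Distributions over polynomials -/

section Distributions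

variable {n m : ℕ}

/-- The polynomial `p(X + s)`. -/
def shift (s : Fin n → ZMod 2) (p : MvPolynomial (Fin n) (ZMod 2)) :
    MvPolynomial (Fin n) (ZMod 2) :=
  MvPolynomial.bind₁ (fun j => MvPolynomial.X j + MvPolynomial.C (s j)) p

theorem eval_shift (s x : Fin n → ZMod 2) (p : MvPolynomial (Fin n) (ZMod 2)) :
    MvPolynomial.eval x (shift s p) = MvPolynomial.eval (x + s) p := by
  simp only [shift, MvPolynomial.eval, MvPolynomial.eval₂Hom_bind₁]
  congr 2
  funext j
  simp

/-- Shift-invariance: for `p` drawn from `P`, the polynomial `p(X + s)` has law `P` for all `s`. -/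
def ShiftInvariant (P : PMF (MvPolynomial (Fin n) (ZMod 2))) : Prop :=
  ∀ s : Fin n → ZMod 2, P.map (shift s) = P

/-- 2-wise independence: the values at two distinct points are uniform and independent. -/
def TwoWiseIndependent (P : PMF (MvPolynomial (Fin n) (ZMod 2))) : Prop :=
  ∀ x y : Fin n → ZMod 2, x ≠ y → ∀ a b : ZMod 2,
    P.toOuterMeasure {p | MvPolynomial.eval x p = a ∧ MvPolynomial.eval y p = b} = 1 / 4

/-- Polynomials form a countable set; every set of polynomials is measurable. -/
instance instMeasurableSpacePoly : MeasurableSpace (MvPolynomial (Fin n) (ZMod 2)) := ⊤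

/-- The law of `(p_1, …, p_m)` with the `p_i` independent and `p_i` drawn from `P i`. -/
def systemLaw (P : Fin m → PMF (MvPolynomial (Fin n) (ZMod 2))) :
    Measure (Fin m → MvPolynomial (Fin n) (ZMod 2)) :=
  Measure.pi fun i => (P i).toMeasure

end Distributions

end PolySystem

end

/-! The uniform superposition over a code transforms into one supported on the dual of that code.
Hence `V̂` lives on the Reed–Solomon code and has total mass one by Parseval, and summing out `x`
leaves only the mass of `Ŵ` on `ℬ`; this is `badStateMass_eq_badErrorMass`.

For the bound, the root set is a product, so `|Ŵ(e)|²` is a product of one-coordinate masses, and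
independence of the `p_i` makes its expectation a product `∏ a_i(e_i)` of subprobability weights.
Two-wise independence gives `a_i(0) = 1/2` and `a_i(z) ≤ 2/q` for `z ≠ 0`, where `q = |F|`
(`integral_coordMass_zero`, `integral_coordMass_le`). On average, then, the error is zero in half of
its coordinates and nearly spread out on the others.

An uncorrectable error either has weight above `(1/2 + ε)m`, or is that close to a nonzero codeword
`c`. A nonzero codeword has at most `k` zeros, so in the second case the error hits a nonzero value
of `c` in at least `(1/2 - ε)m - k` places. A Chernoff bound handles the first case. The second
costs about `(2/q)^((1/2 - ε)m - k) 2^m` per codeword, which beats the `q^k` codewords because `k`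
is at most about `(1/8 - 3ε/4)m`. The expected bad mass is therefore at most `2 exp(-2ε²m)`, and
Markov's inequality splits it evenly between the threshold `μ` and the failure probability `ν`. -/

set_option linter.unusedSectionVars false

noncomputable section

namespace PolySystem

/-! ### Additive characters and Parseval's identity -/

section Signs

variable {F : Type*} [Field F] [Fintype F] [Algebra (ZMod 2) F] {m : ℕ}

/-- The sign `(-1) ^ Tr(a)` as a real number. -/
def realSign (a : F) : ℝ := (-1) ^ (Algebra.trace (ZMod 2) F a).val

theorem traceSign_eq_realSign (a : F) : traceSign a = (realSign a : ℂ) := by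
  simp [traceSign, realSign]

theorem neg_one_pow_zmod_val_add (a b : ZMod 2) :
    (-1 : ℝ) ^ (a + b).val = (-1) ^ a.val * (-1) ^ b.val := by
  have h : ∀ c d : Fin 2, (-1 : ℝ) ^ (c + d).val = (-1) ^ c.val * (-1) ^ d.val := by
    simp [Fin.forall_fin_two]
  exact h a b

theorem realSign_add (a b : F) : realSign (a + b) = realSign a * realSign b := by
  simp only [realSign, map_add, neg_one_pow_zmod_val_add]

theorem realSign_zero : realSign (0 : F) = 1 := by simp [realSign]

theorem realSign_sq (a : F) : realSign a ^ 2 = 1 := by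
  rw [realSign, ← pow_mul, mul_comm, pow_mul]; simp

theorem realSign_sum {ι : Type*} (s : Finset ι) (f : ι → F) :
    realSign (∑ i ∈ s, f i) = ∏ i ∈ s, realSign (f i) := by
  induction s using Finset.induction_on with
  | empty => simp [realSign_zero]
  | insert a s ha ih => rw [Finset.sum_insert ha, Finset.prod_insert ha, realSign_add, ih]

theorem realSign_neg (a : F) : realSign (-a) = realSign a := by
  have h := realSign_add a (-a)
  rw [add_neg_cancel, realSign_zero] at h
  have h2 := realSign_sq a
  calc realSign (-a) = realSign a ^ 2 * realSign (-a) := by rw [h2, one_mul]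
    _ = realSign a * (realSign a * realSign (-a)) := by ring
    _ = realSign a := by rw [← h, mul_one]

/-- Nondegeneracy of the trace form, in the shape used by every cancellation argument: translating
by such a `b` flips the sign of a character sum. -/
theorem exists_realSign_mul_eq_neg_one {a : F} (ha : a ≠ 0) : ∃ b : F, realSign (b * a) = -1 := by
  obtain ⟨b, hb⟩ : ∃ b : F, Algebra.trace (ZMod 2) F (a * b) ≠ 0 := by
    by_contra! h
    exact ha ((traceForm_nondegenerate (ZMod 2) F).1 a fun b => by
      rw [Algebra.traceForm_apply, h])
  refine ⟨b, ?_⟩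
  have key : ∀ t : ZMod 2, t ≠ 0 → (-1 : ℝ) ^ t.val = -1 := by
    intro t ht
    fin_cases t
    · exact absurd rfl ht
    · simp [ZMod.val]
  refine key _ ?_
  rwa [mul_comm]

theorem sum_realSign_mul (a : F) :
    ∑ z : F, realSign (z * a) = if a = 0 then (Fintype.card F : ℝ) else 0 := by
  split_ifs with h
  · simp [h, realSign_zero]
  · obtain ⟨b, hb⟩ := exists_realSign_mul_eq_neg_one h
    have h1 : ∑ z : F, realSign (z * a) = ∑ z : F, realSign ((z + b) * a) :=
      (Equiv.sum_comp (Equiv.addRight b) (fun z => realSign (z * a))).symm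
    simp only [add_mul, realSign_add, hb, mul_neg, mul_one, Finset.sum_neg_distrib] at h1
    linarith

theorem sum_realSign_dotProduct (y : Fin m → F) :
    ∑ z : Fin m → F, realSign (z ⬝ᵥ y) =
      if y = 0 then (Fintype.card F : ℝ) ^ m else 0 := by
  have h : ∑ z : Fin m → F, realSign (z ⬝ᵥ y) = ∏ i, ∑ z : F, realSign (z * y i) := by
    rw [Finset.prod_univ_sum, Fintype.piFinset_univ]
    exact Finset.sum_congr rfl fun z _ => realSign_sum _ _
  rw [h]
  simp only [sum_realSign_mul]
  split_ifs with hy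
  · simp [hy]
  · obtain ⟨i, hi⟩ := Function.ne_iff.mp hy
    exact Finset.prod_eq_zero (Finset.mem_univ i) (if_neg hi)

/-- Parseval's identity for a real kernel with orthogonal columns. -/
theorem sum_sq_of_orthogonal {G H : Type*} [Fintype G] [Fintype H] (K : H → G → ℝ) (N : ℝ)
    (hK : ∀ y y', ∑ z, K z y * K z y' = if y = y' then N else 0) (f : G → ℝ) :
    ∑ z, (∑ y, f y * K z y) ^ 2 = N * ∑ y, f y ^ 2 := by
  have h : ∀ z, (∑ y, f y * K z y) ^ 2 = ∑ y, ∑ y', f y * f y' * (K z y * K z y') := by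
    intro z
    rw [sq, Finset.sum_mul_sum]
    exact Finset.sum_congr rfl fun y _ => Finset.sum_congr rfl fun y' _ => by ring
  simp only [h]
  rw [Finset.sum_comm, Finset.mul_sum]
  refine Finset.sum_congr rfl fun y _ => ?_
  rw [Finset.sum_comm]
  simp only [← Finset.mul_sum, hK, mul_ite, mul_zero]
  rw [Finset.sum_ite_eq Finset.univ y]
  simp
  ring

theorem parseval_realSign (f : F → ℝ) :
    ∑ z : F, (∑ y, f y * realSign (z * y)) ^ 2 = Fintype.card F * ∑ y, f y ^ 2 := by
  refine sum_sq_of_orthogonal (fun z y => realSign (z * y)) _ (fun y y' => ?_) f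
  have := sum_realSign_mul (y - y')
  simp only [sub_eq_add_neg, mul_add, realSign_add, mul_neg, realSign_neg] at this
  rw [this]
  simp [← sub_eq_add_neg, sub_eq_zero]

theorem parseval_realSign_dotProduct (f : (Fin m → F) → ℝ) :
    ∑ z : Fin m → F, (∑ y, f y * realSign (z ⬝ᵥ y)) ^ 2 =
      (Fintype.card F : ℝ) ^ m * ∑ y, f y ^ 2 := by
  refine sum_sq_of_orthogonal (fun z y => realSign (z ⬝ᵥ y)) _ (fun y y' => ?_) f
  have := sum_realSign_dotProduct (y - y')
  simp only [sub_eq_add_neg, dotProduct_add, realSign_add, dotProduct_neg, realSign_neg] at this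
  rw [this]
  simp [← sub_eq_add_neg, sub_eq_zero]

theorem norm_fourier_sq (f : (Fin m → F) → ℝ) (z : Fin m → F) :
    ‖fourier (fun y => (f y : ℂ)) z‖ ^ 2 =
      (∑ y, f y * realSign (z ⬝ᵥ y)) ^ 2 / (Fintype.card F : ℝ) ^ m := by
  have h : fourier (fun y => (f y : ℂ)) z =
      (((1 / Real.sqrt ((Fintype.card F : ℝ) ^ m)) *
        ∑ y, f y * realSign (z ⬝ᵥ y) : ℝ) : ℂ) := by
    simp [fourier, traceSign_eq_realSign]
  rw [h, Complex.norm_real, Real.norm_eq_abs, sq_abs, mul_pow, div_pow, Real.sq_sqrt (by positivity)]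
  ring

theorem sum_norm_fourier_sq (f : (Fin m → F) → ℝ) :
    ∑ z, ‖fourier (fun y => (f y : ℂ)) z‖ ^ 2 = ∑ y, f y ^ 2 := by
  simp only [norm_fourier_sq]
  rw [← Finset.sum_div, parseval_realSign_dotProduct]
  have : (Fintype.card F : ℝ) ^ m ≠ 0 := by positivity
  field_simp

end Signs

/-! ### Fourier support of the code state -/

section CodeMass

variable {F : Type*} [Field F] [Fintype F] {m : ℕ}

/-- A functional that kills `C` but not `x` is the dot product with the vector of its values on the
standard basis. -/
theorem exists_mem_dualCode_dotProduct_ne_zero {C : Submodule F (Fin m → F)} {x : Fin m → F}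
    (hx : x ∉ C) : ∃ c ∈ dualCode C, x ⬝ᵥ c ≠ 0 := by
  obtain ⟨f, hf, hC⟩ := Submodule.exists_dual_map_eq_bot_of_notMem hx inferInstance
  have key : ∀ y : Fin m → F, y ⬝ᵥ (fun i => f (Pi.single i 1)) = f y := by
    intro y
    conv_rhs => rw [pi_eq_sum_univ' y]
    simp [dotProduct, map_sum]
  refine ⟨fun i => f (Pi.single i 1), fun y hy => ?_, by rwa [key]⟩
  rw [key]
  have : f y ∈ C.map f := Submodule.mem_map_of_mem hy
  rwa [hC, Submodule.mem_bot] at this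

theorem mem_badErrors_iff (γ : Fin m ↪ F) (k : ℕ) (ε : ℝ) (e : Fin m → F) :
    e ∈ badErrors γ k ε ↔ e ∉ goodErrors γ k ε := by
  simp [badErrors, goodErrors]

variable [Algebra (ZMod 2) F]

theorem codeAmplitude_eq_ofReal (C : Submodule F (Fin m → F)) :
    codeAmplitude C =
      fun x => ((if x ∈ C then 1 / Real.sqrt (Nat.card C) else 0 : ℝ) : ℂ) := by
  funext x
  unfold codeAmplitude
  split_ifs <;> simp

/-- Translation by a dual codeword `b • c` with `realSign (x ⬝ᵥ b • c) = -1` preserves the amplitude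
and negates every summand, so the sum equals its own negative. -/
theorem fourier_codeAmplitude_dualCode {C : Submodule F (Fin m → F)} {x : Fin m → F}
    (hx : x ∉ C) : fourier (codeAmplitude (dualCode C)) x = 0 := by
  obtain ⟨c, hc, hxc⟩ := exists_mem_dualCode_dotProduct_ne_zero hx
  obtain ⟨b, hb⟩ := exists_realSign_mul_eq_neg_one hxc
  have hbc : b • c ∈ dualCode C := Submodule.smul_mem _ _ hc
  rw [← norm_eq_zero, ← sq_eq_zero_iff, codeAmplitude_eq_ofReal, norm_fourier_sq]
  set g : (Fin m → F) → ℝ := fun y =>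
    (if y ∈ dualCode C then 1 / Real.sqrt (Nat.card (dualCode C)) else 0) * realSign (x ⬝ᵥ y)
    with hg
  have h1 : ∑ y, g y = ∑ y, g (y + b • c) :=
    (Equiv.sum_comp (Equiv.addRight (b • c)) g).symm
  have h2 : ∀ y, g (y + b • c) = - g y := by
    intro y
    simp only [hg, Submodule.add_mem_iff_left _ hbc, dotProduct_add, dotProduct_smul, smul_eq_mul,
      realSign_add, hb]
    ring
  simp only [h2, Finset.sum_neg_distrib] at h1
  have : ∑ y, g y = 0 := by linarith
  rw [this]; simp

theorem sum_norm_fourier_codeAmplitude_sq (C : Submodule F (Fin m → F)) :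
    ∑ x, ‖fourier (codeAmplitude C) x‖ ^ 2 = 1 := by
  rw [codeAmplitude_eq_ofReal, sum_norm_fourier_sq]
  simp only [ite_pow, div_pow, one_pow, Real.sq_sqrt (Nat.cast_nonneg _), zero_pow two_ne_zero]
  rw [← Finset.sum_filter]
  have : 0 < Nat.card C := Nat.card_pos
  have h2 : (Finset.univ.filter fun x => x ∈ C).card = Nat.card C := by
    rw [Nat.card_eq_fintype_card, Fintype.card_subtype]
  simp [h2]

/-- When `x` is off the code both sides of the termwise identity vanish; when `x` is on it, a pair
is bad exactly when its error is. The sum then factors, with the `x`-part equal to one. -/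
theorem badStateMass_eq_badErrorMass {n : ℕ} (γ : Fin m ↪ F) (k : ℕ) (ε : ℝ)
    (σ : F ≃ₗ[ZMod 2] (Fin n → ZMod 2)) (p : Fin m → MvPolynomial (Fin n) (ZMod 2)) :
    badStateMass γ k ε σ p = badErrorMass γ k ε σ p := by
  set V := fourier (codeAmplitude (dualCode (reedSolomon γ k))) with hV
  set W := fourier (rootAmplitude σ p) with hW
  have h : ∀ xe : (Fin m → F) × (Fin m → F),
      (if xe ∈ badPairs γ k ε then ‖V xe.1 * W xe.2‖ ^ 2 else 0) =
        ‖V xe.1‖ ^ 2 * (if xe.2 ∈ badErrors γ k ε then ‖W xe.2‖ ^ 2 else 0) := by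
    rintro ⟨x, e⟩
    by_cases hx : x ∈ reedSolomon γ k
    · have : (x, e) ∈ badPairs γ k ε ↔ e ∈ badErrors γ k ε := by
        simp [badPairs, mem_badErrors_iff, hx]
      simp only [this, norm_mul, mul_pow, mul_ite, mul_zero]
    · have : V x = 0 := fourier_codeAmplitude_dualCode hx
      simp [this]
  rw [badStateMass, badErrorMass, Finset.sum_filter, Finset.sum_filter, ← hV, ← hW]
  simp only [h]
  rw [Fintype.sum_prod_type]
  simp only [← Finset.mul_sum]
  rw [← Finset.sum_mul, sum_norm_fourier_codeAmplitude_sq, one_mul]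

end CodeMass

/-! ### Combinatorics of decoding failures -/

section BadErrors

variable {F : Type*} [Field F] [Fintype F] {m : ℕ}

/-- The codewords of a Reed-Solomon code number at most `q ^ k`. -/
theorem card_reedSolomon_le (γ : Fin m ↪ F) (k : ℕ) :
    (Finset.univ.filter fun x => x ∈ reedSolomon γ k).card ≤ Fintype.card F ^ k := by
  have h : (Finset.univ.filter fun x => x ∈ reedSolomon γ k) ⊆
      Finset.univ.image fun a : Fin k → F => fun i =>
        (((Polynomial.degreeLTEquiv F k).symm a : Polynomial F)).eval (γ i) := by
    intro x hx
    obtain ⟨f, hf, hx⟩ := (mem_reedSolomon γ k x).1 (Finset.mem_filter.1 hx).2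
    refine Finset.mem_image.2
      ⟨Polynomial.degreeLTEquiv F k ⟨f, Polynomial.mem_degreeLT.2 hf⟩, Finset.mem_univ _, ?_⟩
    funext i
    rw [LinearEquiv.symm_apply_apply, hx i]
  calc _ ≤ _ := Finset.card_le_card h
    _ ≤ _ := Finset.card_image_le
    _ = _ := by simp

/-- A nonzero Reed-Solomon codeword has at most `k` zero coordinates. -/
theorem card_zeros_le {γ : Fin m ↪ F} {k : ℕ} {x : Fin m → F} (hx : x ∈ reedSolomon γ k)
    (h0 : x ≠ 0) : (Finset.univ.filter fun i => x i = 0).card ≤ k := by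
  obtain ⟨f, hf, hx⟩ := (mem_reedSolomon γ k x).1 hx
  have hf0 : f ≠ 0 := by
    rintro rfl
    exact h0 (funext fun i => by simp [hx i])
  have h1 : ((Finset.univ.filter fun i => x i = 0).map γ).card ≤ f.natDegree := by
    refine Polynomial.card_le_degree_of_subset_roots fun a ha => ?_
    obtain ⟨i, hi, rfl⟩ := Finset.mem_map.1 (Finset.mem_def.2 ha)
    rw [Polynomial.mem_roots hf0, Polynomial.IsRoot, ← hx i]
    exact (Finset.mem_filter.1 hi).2
  rw [Finset.card_map] at h1
  have h2 : f.natDegree < k := by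
    rwa [Polynomial.natDegree_lt_iff_degree_lt hf0]
  omega

/-- The number of coordinates in which `e` agrees with a nonzero coordinate of `c`. -/
def nonzeroAgreement (c e : Fin m → F) : ℕ :=
  (Finset.univ.filter fun i => e i = c i ∧ c i ≠ 0).card

/-- Every coordinate is an agreement at a nonzero entry of `c`, a zero of `c`, or a disagreement.
Agreements at zeros of `c` are set aside because the value `0` has probability `1/2`, too likely for
a union bound. -/
theorem le_nonzeroAgreement_add {γ : Fin m ↪ F} {k : ℕ} {c : Fin m → F}
    (hc : c ∈ reedSolomon γ k) (h0 : c ≠ 0) (e : Fin m → F) :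
    m ≤ nonzeroAgreement c e + k + hammingNorm (e - c) := by
  have h : (Finset.univ : Finset (Fin m)) ⊆ ((Finset.univ.filter fun i => e i = c i ∧ c i ≠ 0) ∪
      (Finset.univ.filter fun i => c i = 0)) ∪ Finset.univ.filter fun i => (e - c) i ≠ 0 := by
    intro i _
    simp only [Finset.mem_union, Finset.mem_filter, Finset.mem_univ, true_and, Pi.sub_apply,
      sub_ne_zero]
    tauto
  have h1 := Finset.card_le_card h
  rw [Finset.card_univ, Fintype.card_fin] at h1
  have h2 := Finset.card_union_le ((Finset.univ.filter fun i => e i = c i ∧ c i ≠ 0) ∪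
      (Finset.univ.filter fun i => c i = 0)) (Finset.univ.filter fun i => (e - c) i ≠ 0)
  have h3 := Finset.card_union_le (Finset.univ.filter fun i => e i = c i ∧ c i ≠ 0)
      (Finset.univ.filter fun i => c i = 0)
  have h4 := card_zeros_le hc h0
  have h5 : hammingNorm (e - c) = (Finset.univ.filter fun i => (e - c) i ≠ 0).card := by
    simp only [hammingNorm]
  unfold nonzeroAgreement
  omega

/-- A low-weight error that is not close to another codeword is corrected. -/
theorem mem_goodErrors {γ : Fin m ↪ F} {k : ℕ} {ε : ℝ}
    (hlist : (1 / 2 + ε) * m ≤ m - Real.sqrt ((k : ℝ) * m)) {e : Fin m → F}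
    (hwt : (hammingNorm e : ℝ) ≤ (1 / 2 + ε) * m)
    (hfar : ∀ c ∈ reedSolomon γ k, c ≠ 0 → (1 / 2 + ε) * m < hammingNorm (e - c)) :
    e ∈ goodErrors γ k ε := by
  intro x hx
  -- By `hlist` the unique-decoding radius lies inside the list-decoding radius, so the list cannot
  -- miss `x`.
  have hmem : x ∈ rsListDecode γ k (x + e) ∧
      (hammingNorm (x + e - x) : ℝ) ≤ (1 / 2 + ε) * m := by
    refine ⟨Finset.mem_filter.2 ⟨Finset.mem_univ _, hx, ?_⟩, ?_⟩
    · have : hammingNorm (-e) = hammingNorm e := by simp [hammingNorm]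
      rw [sub_add_cancel_left, this]
      exact hwt.trans hlist
    · rwa [add_sub_cancel_left]
  have huniq : ∀ y, y ∈ rsListDecode γ k (x + e) ∧
      (hammingNorm (x + e - y) : ℝ) ≤ (1 / 2 + ε) * m → y = x := by
    rintro y ⟨hy, hy2⟩
    by_contra hne
    have := hfar (y - x) (Submodule.sub_mem _ (Finset.mem_filter.1 hy).2.1 hx) (sub_ne_zero.2 hne)
    have he : e - (y - x) = x + e - y := by abel
    rw [he] at this
    linarith
  have hex : ∃! y, y ∈ rsListDecode γ k (x + e) ∧
      (hammingNorm (x + e - y) : ℝ) ≤ (1 / 2 + ε) * m := ⟨x, hmem, huniq⟩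
  rw [decode, dif_pos hex]
  exact huniq _ hex.choose_spec.1

theorem badErrors_cases {γ : Fin m ↪ F} {k : ℕ} {ε : ℝ}
    (hlist : (1 / 2 + ε) * m ≤ m - Real.sqrt ((k : ℝ) * m)) {e : Fin m → F}
    (he : e ∈ badErrors γ k ε) :
    (1 / 2 + ε) * m < hammingNorm e ∨
      ∃ c ∈ reedSolomon γ k, (1 / 2 - ε) * m - k ≤ nonzeroAgreement c e := by
  by_contra! h
  rw [mem_badErrors_iff] at he
  refine he (mem_goodErrors hlist h.1 fun c hc h0 => ?_)
  have h1 := h.2 c hc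
  have h2 : (m : ℝ) ≤ nonzeroAgreement c e + k + hammingNorm (e - c) := by
    exact_mod_cast le_nonzeroAgreement_add hc h0 e
  linarith

end BadErrors

/-! ### Tail bounds for product weights -/

section TailBounds

theorem sum_biUnion_le_sum {ι κ : Type*} [DecidableEq κ] {f : κ → ℝ} (hf : ∀ x, 0 ≤ f x) (s : Finset ι)
    (t : ι → Finset κ) : ∑ x ∈ s.biUnion t, f x ≤ ∑ i ∈ s, ∑ x ∈ t i, f x := by
  induction s using Finset.induction_on with
  | empty => simp
  | insert a s ha ih =>
    rw [Finset.biUnion_insert, Finset.sum_insert ha]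
    have h := Finset.sum_union_inter (s₁ := t a) (s₂ := s.biUnion t) (f := f)
    have h2 : 0 ≤ ∑ x ∈ t a ∩ s.biUnion t, f x := Finset.sum_nonneg fun x _ => hf x
    linarith

variable {F : Type*} [Field F] [Fintype F] {m : ℕ}

/-- Chernoff bound for the weight of a product distribution with `Pr[e_i = 0] = 1 / 2`. -/
theorem sum_prod_of_lt_hammingNorm_le {a : Fin m → F → ℝ} (ha : ∀ i x, 0 ≤ a i x)
    (ha0 : ∀ i, a i 0 = 1 / 2) (hsum : ∀ i, ∑ x, a i x ≤ 1) {ε : ℝ} (hε : 0 ≤ ε) :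
    ∑ e : Fin m → F with (1 / 2 + ε) * m < hammingNorm e, ∏ i, a i (e i) ≤
      Real.exp (-2 * ε ^ 2 * m) := by
  -- This `s` minimizes the Hoeffding exponent `-s(1/2 + ε) + s/2 + s²/8`, with minimum `-2ε²`.
  set s := 4 * ε with hs
  have hprod : ∀ e : Fin m → F, Real.exp (s * hammingNorm e) =
      ∏ i, (if e i = 0 then 1 else Real.exp s) := by
    intro e
    have : hammingNorm e = (Finset.univ.filter fun i => ¬ e i = 0).card := by
      simp only [hammingNorm, ne_eq]
    rw [Finset.prod_ite, Finset.prod_const_one, one_mul, Finset.prod_const, this, mul_comm,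
      Real.exp_nat_mul]
  have hone : ∀ i, ∑ x, a i x * (if x = 0 then 1 else Real.exp s) ≤ (1 + Real.exp s) / 2 := by
    intro i
    have h1 : ∀ x, a i x * (if x = 0 then 1 else Real.exp s) =
        Real.exp s * a i x - (if x = 0 then (Real.exp s - 1) * a i x else 0) := by
      intro x; split_ifs <;> ring
    simp only [h1]
    rw [Finset.sum_sub_distrib, ← Finset.mul_sum, Finset.sum_ite_eq' Finset.univ (0 : F)]
    simp only [Finset.mem_univ, if_true, ha0]
    have := mul_le_mul_of_nonneg_left (hsum i) (Real.exp_pos s).le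
    linarith
  have hexp : (1 + Real.exp s) / 2 ≤ Real.exp (2 * ε + 2 * ε ^ 2) := by
    have h1 : (1 + Real.exp s) / 2 = Real.exp (2 * ε) * Real.cosh (2 * ε) := by
      rw [Real.cosh_eq, hs, Real.exp_neg]
      have : Real.exp (4 * ε) = Real.exp (2 * ε) * Real.exp (2 * ε) := by
        rw [← Real.exp_add]; ring_nf
      rw [this]
      field_simp
      ring
    rw [h1, Real.exp_add]
    gcongr
    refine (Real.cosh_le_exp_half_sq _).trans (le_of_eq ?_)
    ring_nf
  calc ∑ e : Fin m → F with (1 / 2 + ε) * m < hammingNorm e, ∏ i, a i (e i)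
      ≤ ∑ e : Fin m → F with (1 / 2 + ε) * m < hammingNorm e,
          Real.exp (-s * ((1 / 2 + ε) * m)) * ∏ i, (a i (e i) *
            (if e i = 0 then 1 else Real.exp s)) := by
        refine Finset.sum_le_sum fun e he => ?_
        rw [Finset.prod_mul_distrib, ← hprod, mul_left_comm, ← Real.exp_add]
        refine le_mul_of_one_le_right (Finset.prod_nonneg fun i _ => ha i _) ?_
        rw [Real.one_le_exp_iff]
        have := mul_le_mul_of_nonneg_left (Finset.mem_filter.1 he).2.le (by positivity : 0 ≤ s)
        linarith
    _ ≤ ∑ e : Fin m → F, Real.exp (-s * ((1 / 2 + ε) * m)) * ∏ i, (a i (e i) *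
            (if e i = 0 then 1 else Real.exp s)) := by
        refine Finset.sum_le_sum_of_subset_of_nonneg (Finset.filter_subset _ _) fun e _ _ => ?_
        refine mul_nonneg (Real.exp_pos _).le (Finset.prod_nonneg fun i _ => mul_nonneg (ha i _) ?_)
        split_ifs <;> positivity
    _ = Real.exp (-s * ((1 / 2 + ε) * m)) *
          ∏ i, ∑ x, a i x * (if x = 0 then 1 else Real.exp s) := by
        rw [← Finset.mul_sum, Finset.prod_univ_sum, Fintype.piFinset_univ]
    _ ≤ Real.exp (-s * ((1 / 2 + ε) * m)) * ∏ i : Fin m, Real.exp (2 * ε + 2 * ε ^ 2) := by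
        gcongr with i
        · intro i _
          refine Finset.sum_nonneg fun x _ => mul_nonneg (ha i x) ?_
          split_ifs <;> positivity
        · exact (hone i).trans hexp
    _ = Real.exp (-2 * ε ^ 2 * m) := by
        rw [Finset.prod_const, Finset.card_univ, Fintype.card_fin, ← Real.exp_nat_mul,
          ← Real.exp_add, hs]
        ring_nf

/-- A product distribution with small atoms off `0` rarely agrees with a fixed word. -/
theorem sum_prod_of_le_nonzeroAgreement_le {a : Fin m → F → ℝ} (ha : ∀ i x, 0 ≤ a i x)
    (hsum : ∀ i, ∑ x, a i x ≤ 1) {X : ℝ} (hX : 1 ≤ X)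
    (hatom : ∀ i x, x ≠ 0 → a i x ≤ X⁻¹) (c : Fin m → F) (t : ℝ) :
    ∑ e : Fin m → F with t ≤ nonzeroAgreement c e, ∏ i, a i (e i) ≤ X ^ (-t) * 2 ^ m := by
  have hX0 : 0 < X := by linarith
  have hprod : ∀ e : Fin m → F, X ^ (nonzeroAgreement c e : ℝ) =
      ∏ i, (if e i = c i ∧ c i ≠ 0 then X else 1) := by
    intro e
    rw [Finset.prod_ite, Finset.prod_const_one, mul_one, Finset.prod_const, Real.rpow_natCast,
      nonzeroAgreement]
  -- Exponential moment with base `X`: the only reweighted atom has weight at most `X⁻¹`, so it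
  -- contributes at most `1` after reweighting, on top of total mass at most `1`.
  have hone : ∀ i, ∑ x, a i x * (if x = c i ∧ c i ≠ 0 then X else 1) ≤ 2 := by
    intro i
    calc ∑ x, a i x * (if x = c i ∧ c i ≠ 0 then X else 1)
        ≤ ∑ x, (a i x + if x = c i then 1 else 0) := by
          refine Finset.sum_le_sum fun x _ => ?_
          have := ha i x
          split_ifs with h1 h2 h2
          · have h3 := mul_le_mul_of_nonneg_right (hatom i x (h1.1 ▸ h1.2)) hX0.le
            rw [inv_mul_cancel₀ hX0.ne'] at h3
            linarith
          · exact absurd h1.1 h2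
          · linarith
          · linarith
      _ ≤ 2 := by
          rw [Finset.sum_add_distrib, Finset.sum_ite_eq' Finset.univ (c i)]
          have := hsum i
          simp only [Finset.mem_univ, if_true]
          linarith
  have hterm : ∀ e : Fin m → F, 0 ≤ ∏ i, (a i (e i) * if e i = c i ∧ c i ≠ 0 then X else 1) := by
    refine fun e => Finset.prod_nonneg fun i _ => mul_nonneg (ha i _) ?_
    split_ifs <;> positivity
  calc ∑ e : Fin m → F with t ≤ nonzeroAgreement c e, ∏ i, a i (e i)
      ≤ ∑ e : Fin m → F with t ≤ nonzeroAgreement c e, X ^ (-t) *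
          ∏ i, (a i (e i) * if e i = c i ∧ c i ≠ 0 then X else 1) := by
        refine Finset.sum_le_sum fun e he => ?_
        rw [Finset.prod_mul_distrib, ← hprod, mul_left_comm, ← Real.rpow_add hX0]
        refine le_mul_of_one_le_right (Finset.prod_nonneg fun i _ => ha i _) ?_
        refine Real.one_le_rpow hX ?_
        have := (Finset.mem_filter.1 he).2
        linarith
    _ ≤ ∑ e : Fin m → F, X ^ (-t) *
          ∏ i, (a i (e i) * if e i = c i ∧ c i ≠ 0 then X else 1) :=
        Finset.sum_le_sum_of_subset_of_nonneg (Finset.filter_subset _ _) fun e _ _ =>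
          mul_nonneg (by positivity) (hterm e)
    _ = X ^ (-t) * ∏ i, ∑ x, a i x * (if x = c i ∧ c i ≠ 0 then X else 1) := by
        rw [← Finset.mul_sum, Finset.prod_univ_sum, Fintype.piFinset_univ]
    _ ≤ X ^ (-t) * ∏ i : Fin m, 2 := by
        gcongr with i
        · intro i _
          refine Finset.sum_nonneg fun x _ => mul_nonneg (ha i x) ?_
          split_ifs <;> positivity
        · exact hone i
    _ = X ^ (-t) * 2 ^ m := by simp

/-- The mass of the uncorrectable errors under a product distribution. -/
theorem sum_badErrors_prod_le {a : Fin m → F → ℝ} (ha : ∀ i x, 0 ≤ a i x)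
    (ha0 : ∀ i, a i 0 = 1 / 2) (hsum : ∀ i, ∑ x, a i x ≤ 1) {X : ℝ} (hX : 1 ≤ X)
    (hatom : ∀ i x, x ≠ 0 → a i x ≤ X⁻¹) {ε : ℝ} (hε : 0 ≤ ε) (γ : Fin m ↪ F) {k : ℕ}
    (hlist : (1 / 2 + ε) * m ≤ m - Real.sqrt ((k : ℝ) * m)) :
    ∑ e : Fin m → F with e ∈ badErrors γ k ε, ∏ i, a i (e i) ≤
      Real.exp (-2 * ε ^ 2 * m) +
        (Fintype.card F : ℝ) ^ k * (X ^ (-((1 / 2 - ε) * m - k)) * 2 ^ m) := by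
  have hnn : ∀ e : Fin m → F, 0 ≤ ∏ i, a i (e i) := fun e => Finset.prod_nonneg fun i _ => ha i _
  set t := (1 / 2 - ε) * m - k with ht
  set A := Finset.univ.filter fun e : Fin m → F => (1 / 2 + ε) * m < hammingNorm e with hA
  set B := (Finset.univ.filter fun x => x ∈ reedSolomon γ k).biUnion fun c =>
    Finset.univ.filter fun e : Fin m → F => t ≤ nonzeroAgreement c e with hB
  have hsub : (Finset.univ.filter fun e : Fin m → F => e ∈ badErrors γ k ε) ⊆ A ∪ B := by
    intro e he
    rcases badErrors_cases hlist (Finset.mem_filter.1 he).2 with h | ⟨c, hc, h⟩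
    · exact Finset.mem_union_left _ (Finset.mem_filter.2 ⟨Finset.mem_univ _, h⟩)
    · exact Finset.mem_union_right _ (Finset.mem_biUnion.2
        ⟨c, Finset.mem_filter.2 ⟨Finset.mem_univ _, hc⟩,
          Finset.mem_filter.2 ⟨Finset.mem_univ _, h⟩⟩)
  have hBsum : ∑ e ∈ B, ∏ i, a i (e i) ≤
      (Fintype.card F : ℝ) ^ k * (X ^ (-t) * 2 ^ m) := by
    calc ∑ e ∈ B, ∏ i, a i (e i)
        ≤ ∑ c ∈ Finset.univ.filter (fun x => x ∈ reedSolomon γ k),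
            ∑ e : Fin m → F with t ≤ nonzeroAgreement c e, ∏ i, a i (e i) :=
          sum_biUnion_le_sum hnn _ _
      _ ≤ ∑ c ∈ Finset.univ.filter (fun x => x ∈ reedSolomon γ k), (X ^ (-t) * 2 ^ m) :=
          Finset.sum_le_sum fun c _ => by
            have h := sum_prod_of_le_nonzeroAgreement_le ha hsum hX hatom c t
            exact h
      _ ≤ _ := by
          rw [Finset.sum_const, nsmul_eq_mul]
          gcongr
          exact_mod_cast card_reedSolomon_le γ k
  calc _ ≤ ∑ e ∈ A ∪ B, ∏ i, a i (e i) :=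
        Finset.sum_le_sum_of_subset_of_nonneg hsub fun e _ _ => hnn e
    _ ≤ ∑ e ∈ A, ∏ i, a i (e i) + ∑ e ∈ B, ∏ i, a i (e i) := by
        rw [← Finset.sum_union_inter]
        exact le_add_of_nonneg_right (Finset.sum_nonneg fun e _ => hnn e)
    _ ≤ _ := add_le_add (sum_prod_of_lt_hammingNorm_le ha ha0 hsum hε) hBsum

end TailBounds

/-! ### Fourier mass of a single random polynomial -/

section CoordinateMass

variable {F : Type*} [Field F] [Fintype F] [Algebra (ZMod 2) F] {m n : ℕ}

/-- The indicator of the roots of `p`. -/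
def rootIndicator (σ : F ≃ₗ[ZMod 2] (Fin n → ZMod 2)) (p : MvPolynomial (Fin n) (ZMod 2))
    (x : F) : ℝ :=
  if MvPolynomial.eval (σ x) p = 0 then 1 else 0

/-- The number of roots of `p`. -/
def rootCount (σ : F ≃ₗ[ZMod 2] (Fin n → ZMod 2)) (p : MvPolynomial (Fin n) (ZMod 2)) : ℝ :=
  ∑ x, rootIndicator σ p x

/-- The squared Fourier coefficient at `z` of the uniform superposition over the roots of `p`. -/
def coordMass (σ : F ≃ₗ[ZMod 2] (Fin n → ZMod 2)) (p : MvPolynomial (Fin n) (ZMod 2))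
    (z : F) : ℝ :=
  (∑ x, rootIndicator σ p x * realSign (z * x)) ^ 2 / (rootCount σ p * Fintype.card F)

variable (σ : F ≃ₗ[ZMod 2] (Fin n → ZMod 2))

theorem rootIndicator_nonneg (p : MvPolynomial (Fin n) (ZMod 2)) (x : F) :
    0 ≤ rootIndicator σ p x := by
  unfold rootIndicator; split_ifs <;> norm_num

theorem rootIndicator_sq (p : MvPolynomial (Fin n) (ZMod 2)) (x : F) :
    rootIndicator σ p x ^ 2 = rootIndicator σ p x := by
  unfold rootIndicator; split_ifs <;> norm_num

theorem rootCount_nonneg (p : MvPolynomial (Fin n) (ZMod 2)) : 0 ≤ rootCount σ p :=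
  Finset.sum_nonneg fun x _ => rootIndicator_nonneg σ p x

theorem card_rootSet (p : Fin m → MvPolynomial (Fin n) (ZMod 2)) :
    ((rootSet σ p).card : ℝ) = ∏ i, rootCount σ (p i) := by
  have h : rootSet σ p = Fintype.piFinset fun i =>
      Finset.univ.filter fun x => MvPolynomial.eval (σ x) (p i) = 0 := by
    ext e
    simp [rootSet, Fintype.mem_piFinset]
  rw [h, Fintype.card_piFinset, Nat.cast_prod]
  simp [rootCount, rootIndicator]

theorem rootAmplitude_eq_ofReal (p : Fin m → MvPolynomial (Fin n) (ZMod 2)) :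
    rootAmplitude σ p = fun e => ((1 / Real.sqrt (∏ i, rootCount σ (p i)) *
      ∏ i, rootIndicator σ (p i) (e i) : ℝ) : ℂ) := by
  funext e
  rw [rootAmplitude, ← card_rootSet]
  split_ifs with h
  · have : ∏ i, rootIndicator σ (p i) (e i) = 1 :=
      Finset.prod_eq_one fun i _ => if_pos ((Finset.mem_filter.1 h).2 i)
    rw [this]; simp
  · have : ∃ i, MvPolynomial.eval (σ (e i)) (p i) ≠ 0 := by
      by_contra! hc
      exact h (Finset.mem_filter.2 ⟨Finset.mem_univ _, hc⟩)
    obtain ⟨i, hi⟩ := this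
    have : ∏ i, rootIndicator σ (p i) (e i) = 0 :=
      Finset.prod_eq_zero (Finset.mem_univ i) (if_neg hi)
    rw [this]; simp

theorem norm_fourier_rootAmplitude_sq (p : Fin m → MvPolynomial (Fin n) (ZMod 2))
    (z : Fin m → F) :
    ‖fourier (rootAmplitude σ p) z‖ ^ 2 = ∏ i, coordMass σ (p i) (z i) := by
  have h : ∑ y : Fin m → F, 1 / Real.sqrt (∏ i, rootCount σ (p i)) *
      (∏ i, rootIndicator σ (p i) (y i)) * realSign (z ⬝ᵥ y) =
      1 / Real.sqrt (∏ i, rootCount σ (p i)) *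
        ∏ i, ∑ x, rootIndicator σ (p i) x * realSign (z i * x) := by
    rw [Finset.prod_univ_sum, Fintype.piFinset_univ, Finset.mul_sum]
    refine Finset.sum_congr rfl fun y _ => ?_
    rw [Finset.prod_mul_distrib, mul_assoc, dotProduct, realSign_sum]
  rw [rootAmplitude_eq_ofReal, norm_fourier_sq, h, mul_pow, div_pow, one_pow,
    Real.sq_sqrt (Finset.prod_nonneg fun i _ => rootCount_nonneg σ (p i))]
  simp only [coordMass]
  rw [Finset.prod_div_distrib, Finset.prod_mul_distrib, Finset.prod_pow, Finset.prod_const,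
    Finset.card_univ, Fintype.card_fin, one_div, div_eq_mul_inv, div_eq_mul_inv, mul_inv]
  ring

theorem coordMass_nonneg (p : MvPolynomial (Fin n) (ZMod 2)) (z : F) : 0 ≤ coordMass σ p z :=
  div_nonneg (sq_nonneg _) (mul_nonneg (rootCount_nonneg σ p) (Nat.cast_nonneg _))

/-- Parseval gives equality when `p` has a root. Otherwise the division by zero makes every mass
`0`, hence only an inequality. -/
theorem sum_coordMass_le (p : MvPolynomial (Fin n) (ZMod 2)) : ∑ z, coordMass σ p z ≤ 1 := by
  simp only [coordMass]
  rw [← Finset.sum_div, parseval_realSign]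
  simp only [rootIndicator_sq]
  rw [← rootCount, mul_comm]
  exact div_self_le_one _

theorem coordMass_le_one (p : MvPolynomial (Fin n) (ZMod 2)) (z : F) : coordMass σ p z ≤ 1 :=
  (Finset.single_le_sum (fun z _ => coordMass_nonneg σ p z) (Finset.mem_univ z)).trans
    (sum_coordMass_le σ p)

theorem coordMass_zero (p : MvPolynomial (Fin n) (ZMod 2)) :
    coordMass σ p 0 = rootCount σ p / Fintype.card F := by
  simp only [coordMass, zero_mul, realSign_zero, mul_one]
  rw [← rootCount]
  by_cases h : rootCount σ p = 0
  · simp [h]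
  · field_simp

/-- Removes the random denominator, the root count `R`, so that second moments suffice. If `R ≥
q/4`, replace it by `q/4`, and centering the indicator is free because a nontrivial character sums
to zero. If `R < q/4`, the mass is at most `R/q ≤ 1/4`, while the deviation `(R - q/2)²` already
exceeds `q²/16`. -/
theorem coordMass_le_of_ne_zero (p : MvPolynomial (Fin n) (ZMod 2)) {z : F} (hz : z ≠ 0) :
    coordMass σ p z ≤ 4 / (Fintype.card F : ℝ) ^ 2 *
      ((∑ x, (rootIndicator σ p x - 1 / 2) * realSign (z * x)) ^ 2 +
        (∑ x, (rootIndicator σ p x - 1 / 2) * 1) ^ 2) := by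
  have hq : 0 < (Fintype.card F : ℝ) := by exact_mod_cast Fintype.card_pos
  have hsign : ∑ x : F, realSign (z * x) = 0 := by
    have := sum_realSign_mul z
    rw [if_neg hz] at this
    simpa only [mul_comm z] using this
  have h1 : ∑ x, (rootIndicator σ p x - 1 / 2) * realSign (z * x) =
      ∑ x, rootIndicator σ p x * realSign (z * x) := by
    simp only [sub_mul]
    rw [Finset.sum_sub_distrib, ← Finset.mul_sum, hsign]
    ring
  have h2 : ∑ x, (rootIndicator σ p x - 1 / 2) * 1 = rootCount σ p - Fintype.card F / 2 := by
    simp only [mul_one]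
    rw [Finset.sum_sub_distrib, ← rootCount]
    simp
    ring
  rw [h1, h2, coordMass]
  set S := ∑ x, rootIndicator σ p x * realSign (z * x) with hS
  set q : ℝ := (Fintype.card F : ℝ) with hq'
  have hR := rootCount_nonneg σ p
  set R := rootCount σ p with hR'
  have hSR : S ^ 2 ≤ R ^ 2 := by
    rw [sq_le_sq, abs_of_nonneg hR]
    refine (Finset.abs_sum_le_sum_abs _ _).trans (le_of_eq (Finset.sum_congr rfl fun x _ => ?_))
    have : |realSign (z * x)| = 1 := by
      rw [← sq_eq_sq₀ (abs_nonneg _) zero_le_one, sq_abs, realSign_sq, one_pow]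
    rw [abs_mul, this, mul_one, abs_of_nonneg (rootIndicator_nonneg σ p x)]
  rcases le_or_gt (q / 4) R with h | h
  · have hR0 : 0 < R := by linarith
    calc S ^ 2 / (R * q) ≤ S ^ 2 / (q / 4 * q) := by gcongr
      _ = 4 / q ^ 2 * S ^ 2 := by field_simp
      _ ≤ _ := by
        gcongr
        exact le_add_of_nonneg_right (sq_nonneg _)
  · have h3 : S ^ 2 / (R * q) ≤ 1 / 4 := by
      rcases hR.eq_or_lt with h0 | h0
      · rw [← h0]; norm_num
      · rw [div_le_iff₀ (by positivity)]
        nlinarith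
    have h4 : q ^ 2 / 16 ≤ S ^ 2 + (R - q / 2) ^ 2 := by nlinarith [sq_nonneg S]
    calc S ^ 2 / (R * q) ≤ 1 / 4 := h3
      _ = 4 / q ^ 2 * (q ^ 2 / 16) := by field_simp; norm_num
      _ ≤ _ := by gcongr

variable {P : PMF (MvPolynomial (Fin n) (ZMod 2))}

theorem integrable_of_abs_le (P : PMF (MvPolynomial (Fin n) (ZMod 2)))
    (f : MvPolynomial (Fin n) (ZMod 2) → ℝ) (C : ℝ) (hf : ∀ p, |f p| ≤ C) :
    Integrable f P.toMeasure :=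
  Integrable.of_bound (Measurable.aestronglyMeasurable fun _ _ => trivial) C
    (Eventually.of_forall fun p => by simpa using hf p)

theorem abs_rootIndicator_le (p : MvPolynomial (Fin n) (ZMod 2)) (x : F) :
    |rootIndicator σ p x| ≤ 1 := by
  unfold rootIndicator; split_ifs <;> simp

theorem integral_rootIndicator_mul (hP : TwoWiseIndependent P) {x y : F} (hxy : x ≠ y) :
    ∫ p, rootIndicator σ p x * rootIndicator σ p y ∂P.toMeasure = 1 / 4 := by
  have hm : ∀ s : Set (MvPolynomial (Fin n) (ZMod 2)), MeasurableSet s := fun _ => trivial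
  have h : (fun p => rootIndicator σ p x * rootIndicator σ p y) = Set.indicator
      {p | MvPolynomial.eval (σ x) p = 0 ∧ MvPolynomial.eval (σ y) p = 0} 1 := by
    funext p
    by_cases h1 : MvPolynomial.eval (σ x) p = 0 <;> by_cases h2 : MvPolynomial.eval (σ y) p = 0 <;>
      simp [rootIndicator, h1, h2]
  rw [h, integral_indicator_one (hm _), measureReal_def,
    PMF.toMeasure_apply_eq_toOuterMeasure_apply _ (hm _), hP _ _ (σ.injective.ne hxy)]
  simp

/-- The one-point marginal comes from the two-point law by splitting on the value at an auxiliary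
second point, `x + 1`. -/
theorem integral_rootIndicator (hP : TwoWiseIndependent P) (x : F) :
    ∫ p, rootIndicator σ p x ∂P.toMeasure = 1 / 2 := by
  have hm : ∀ s : Set (MvPolynomial (Fin n) (ZMod 2)), MeasurableSet s := fun _ => trivial
  have hne : σ x ≠ σ (x + 1) := σ.injective.ne (by simp)
  have h : (fun p => rootIndicator σ p x) = Set.indicator
      ({p | MvPolynomial.eval (σ x) p = 0 ∧ MvPolynomial.eval (σ (x + 1)) p = 0} ∪
        {p | MvPolynomial.eval (σ x) p = 0 ∧ MvPolynomial.eval (σ (x + 1)) p = 1}) 1 := by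
    have key : ∀ t : ZMod 2, t = 0 ∨ t = 1 := by decide
    funext p
    have := key (MvPolynomial.eval (σ (x + 1)) p)
    by_cases h1 : MvPolynomial.eval (σ x) p = 0
    · simp only [rootIndicator, h1, if_true]
      rw [Set.indicator_of_mem]
      · rfl
      · rcases this with h2 | h2
        · exact Or.inl ⟨h1, h2⟩
        · exact Or.inr ⟨h1, h2⟩
    · simp only [rootIndicator, h1, if_false]
      rw [Set.indicator_of_notMem]
      rintro (h2 | h2) <;> exact h1 h2.1
  have hd : Disjoint
      {p | MvPolynomial.eval (σ x) p = 0 ∧ MvPolynomial.eval (σ (x + 1)) p = 0}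
      {p | MvPolynomial.eval (σ x) p = 0 ∧ MvPolynomial.eval (σ (x + 1)) p = 1} := by
    rw [Set.disjoint_left]
    rintro p ⟨-, h1⟩ ⟨-, h2⟩
    rw [h1] at h2
    exact zero_ne_one h2
  rw [h, integral_indicator_one (hm _), measureReal_union hd (hm _), measureReal_def,
    measureReal_def, PMF.toMeasure_apply_eq_toOuterMeasure_apply _ (hm _),
    PMF.toMeasure_apply_eq_toOuterMeasure_apply _ (hm _), hP _ _ hne, hP _ _ hne]
  simp
  norm_num

theorem integral_centered_mul (hP : TwoWiseIndependent P) (x y : F) :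
    ∫ p, (rootIndicator σ p x - 1 / 2) * (rootIndicator σ p y - 1 / 2) ∂P.toMeasure =
      if x = y then 1 / 4 else 0 := by
  have hi : ∀ x : F, Integrable (fun p => rootIndicator σ p x) P.toMeasure := fun x =>
    integrable_of_abs_le P _ 1 fun p => abs_rootIndicator_le σ p x
  split_ifs with h
  · subst h
    have : ∀ p, (rootIndicator σ p x - 1 / 2) * (rootIndicator σ p x - 1 / 2) = 1 / 4 := by
      intro p
      have := rootIndicator_sq σ p x
      nlinarith
    simp only [this]
    simp
  · have hxy : Integrable (fun p => rootIndicator σ p x * rootIndicator σ p y) P.toMeasure :=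
      integrable_of_abs_le P _ 1 fun p => by
        rw [abs_mul]
        exact mul_le_one₀ (abs_rootIndicator_le σ p x) (abs_nonneg _) (abs_rootIndicator_le σ p y)
    have : ∀ p, (rootIndicator σ p x - 1 / 2) * (rootIndicator σ p y - 1 / 2) =
        rootIndicator σ p x * rootIndicator σ p y -
          (1 / 2 * rootIndicator σ p x + 1 / 2 * rootIndicator σ p y) + 1 / 4 := by
      intro p; ring
    simp only [this]
    have hxy' : Integrable (fun p => 1 / 2 * rootIndicator σ p x + 1 / 2 * rootIndicator σ p y)
        P.toMeasure := ((hi x).const_mul _).add ((hi y).const_mul _)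
    have hsub : Integrable (fun p => rootIndicator σ p x * rootIndicator σ p y -
        (1 / 2 * rootIndicator σ p x + 1 / 2 * rootIndicator σ p y)) P.toMeasure := hxy.sub hxy'
    rw [integral_add hsub (integrable_const _), integral_sub hxy hxy',
      integral_add ((hi x).const_mul _) ((hi y).const_mul _), integral_const_mul,
      integral_const_mul, integral_rootIndicator σ hP, integral_rootIndicator σ hP,
      integral_rootIndicator_mul σ hP h]
    simp
    norm_num

theorem abs_centered_le (p : MvPolynomial (Fin n) (ZMod 2)) (x : F) :
    |rootIndicator σ p x - 1 / 2| ≤ 1 := by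
  unfold rootIndicator; split_ifs <;> norm_num [abs_le]

theorem integrable_centered_sum_sq (P : PMF (MvPolynomial (Fin n) (ZMod 2))) (s : F → ℝ) :
    Integrable (fun p => (∑ x, (rootIndicator σ p x - 1 / 2) * s x) ^ 2) P.toMeasure := by
  refine integrable_of_abs_le P _ ((∑ x, |s x|) ^ 2) fun p => ?_
  rw [abs_pow]
  gcongr
  refine (Finset.abs_sum_le_sum_abs _ _).trans (Finset.sum_le_sum fun x _ => ?_)
  rw [abs_mul]
  exact mul_le_of_le_one_left (abs_nonneg _) (abs_centered_le σ p x)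

/-- The centered indicators are pairwise uncorrelated with variance `1/4`, so only the diagonal
survives. -/
theorem integral_centered_sum_sq (hP : TwoWiseIndependent P) (s : F → ℝ) :
    ∫ p, (∑ x, (rootIndicator σ p x - 1 / 2) * s x) ^ 2 ∂P.toMeasure =
      (∑ x, s x ^ 2) / 4 := by
  have h : ∀ p, (∑ x, (rootIndicator σ p x - 1 / 2) * s x) ^ 2 =
      ∑ x, ∑ y, s x * s y * ((rootIndicator σ p x - 1 / 2) * (rootIndicator σ p y - 1 / 2)) := by
    intro p
    rw [sq, Finset.sum_mul_sum]
    exact Finset.sum_congr rfl fun x _ => Finset.sum_congr rfl fun y _ => by ring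
  have hi : ∀ x y : F, Integrable (fun p => s x * s y *
      ((rootIndicator σ p x - 1 / 2) * (rootIndicator σ p y - 1 / 2))) P.toMeasure := fun x y =>
    (integrable_of_abs_le P _ 1 fun p => by
      rw [abs_mul]
      exact mul_le_one₀ (abs_centered_le σ p x) (abs_nonneg _) (abs_centered_le σ p y)).const_mul _
  simp only [h]
  rw [integral_finsetSum _ fun x _ => integrable_finsetSum _ fun y _ => hi x y, Finset.sum_div]
  refine Finset.sum_congr rfl fun x _ => ?_
  rw [integral_finsetSum _ fun y _ => hi x y]
  simp only [integral_const_mul, integral_centered_mul σ hP, mul_ite, mul_zero]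
  rw [Finset.sum_ite_eq Finset.univ x]
  simp
  ring

theorem integrable_coordMass (P : PMF (MvPolynomial (Fin n) (ZMod 2))) (z : F) :
    Integrable (fun p => coordMass σ p z) P.toMeasure :=
  integrable_of_abs_le P _ 1 fun p => by
    rw [abs_of_nonneg (coordMass_nonneg σ p z)]
    exact coordMass_le_one σ p z

theorem integral_coordMass_zero (hP : TwoWiseIndependent P) :
    ∫ p, coordMass σ p 0 ∂P.toMeasure = 1 / 2 := by
  simp only [coordMass_zero, rootCount]
  rw [integral_div, integral_finsetSum _ fun x _ =>
    integrable_of_abs_le P _ 1 fun p => abs_rootIndicator_le σ p x]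
  simp only [integral_rootIndicator σ hP]
  simp

theorem sum_integral_coordMass_le (P : PMF (MvPolynomial (Fin n) (ZMod 2))) :
    ∑ z, ∫ p, coordMass σ p z ∂P.toMeasure ≤ 1 := by
  rw [← integral_finsetSum _ fun z _ => integrable_coordMass σ P z]
  calc ∫ p, ∑ z, coordMass σ p z ∂P.toMeasure ≤ ∫ _, (1 : ℝ) ∂P.toMeasure :=
        integral_mono (integrable_finsetSum _ fun z _ => integrable_coordMass σ P z)
          (integrable_const _) fun p => sum_coordMass_le σ p
    _ = 1 := by simp

/-- Both squares in the pointwise bound have coefficients `±1`, hence expectation `q/4`, and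
`(4/q²)(q/4 + q/4) = 2/q`. -/
theorem integral_coordMass_le (hP : TwoWiseIndependent P) {z : F} (hz : z ≠ 0) :
    ∫ p, coordMass σ p z ∂P.toMeasure ≤ ((Fintype.card F : ℝ) / 2)⁻¹ := by
  have hq : (Fintype.card F : ℝ) ≠ 0 := by exact_mod_cast Fintype.card_ne_zero
  have h1 := integrable_centered_sum_sq σ P fun x => realSign (z * x)
  have h2 := integrable_centered_sum_sq σ P fun _ => 1
  refine (integral_mono (integrable_coordMass σ P z) ((h1.add h2).const_mul _)
    fun p => coordMass_le_of_ne_zero σ p hz).trans (le_of_eq ?_)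
  simp only [Pi.add_apply]
  rw [integral_const_mul, integral_add h1 h2, integral_centered_sum_sq σ hP,
    integral_centered_sum_sq σ hP]
  simp only [realSign_sq, one_pow]
  simp
  field_simp
  norm_num

end CoordinateMass

/-! ### Expectation over the random system -/

section SystemMass

variable {F : Type*} [Field F] [Fintype F] [Algebra (ZMod 2) F] {m n : ℕ}

instance isProbabilityMeasure_systemLaw (P : Fin m → PMF (MvPolynomial (Fin n) (ZMod 2))) :
    IsProbabilityMeasure (systemLaw P) := by
  unfold systemLaw; infer_instance

theorem badErrorMass_nonneg (γ : Fin m ↪ F) (k : ℕ) (ε : ℝ)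
    (σ : F ≃ₗ[ZMod 2] (Fin n → ZMod 2)) (p : Fin m → MvPolynomial (Fin n) (ZMod 2)) :
    0 ≤ badErrorMass γ k ε σ p :=
  Finset.sum_nonneg fun _ _ => sq_nonneg _

theorem integrable_prod_coordMass (σ : F ≃ₗ[ZMod 2] (Fin n → ZMod 2))
    (P : Fin m → PMF (MvPolynomial (Fin n) (ZMod 2))) (e : Fin m → F) :
    Integrable (fun p : Fin m → MvPolynomial (Fin n) (ZMod 2) => ∏ i, coordMass σ (p i) (e i))
      (systemLaw P) :=
  Integrable.fintype_prod fun i => integrable_coordMass σ (P i) (e i)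

theorem integrable_badErrorMass (γ : Fin m ↪ F) (k : ℕ) (ε : ℝ)
    (σ : F ≃ₗ[ZMod 2] (Fin n → ZMod 2)) (P : Fin m → PMF (MvPolynomial (Fin n) (ZMod 2))) :
    Integrable (fun p => badErrorMass γ k ε σ p) (systemLaw P) := by
  simp only [badErrorMass, norm_fourier_rootAmplitude_sq]
  exact integrable_finsetSum _ fun e _ => integrable_prod_coordMass σ P e

theorem integral_badErrorMass (γ : Fin m ↪ F) (k : ℕ) (ε : ℝ)
    (σ : F ≃ₗ[ZMod 2] (Fin n → ZMod 2)) (P : Fin m → PMF (MvPolynomial (Fin n) (ZMod 2))) :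
    ∫ p, badErrorMass γ k ε σ p ∂systemLaw P =
      ∑ e : Fin m → F with e ∈ badErrors γ k ε,
        ∏ i, ∫ p, coordMass σ p (e i) ∂(P i).toMeasure := by
  simp only [badErrorMass, norm_fourier_rootAmplitude_sq]
  rw [integral_finsetSum _ fun e _ => integrable_prod_coordMass σ P e]
  refine Finset.sum_congr rfl fun e _ => ?_
  exact integral_fintype_prod_eq_prod fun i p => coordMass σ p (e i)

theorem integral_badErrorMass_le (γ : Fin m ↪ F) {k : ℕ} {ε : ℝ} (hε : 0 ≤ ε)
    (σ : F ≃ₗ[ZMod 2] (Fin n → ZMod 2)) {P : Fin m → PMF (MvPolynomial (Fin n) (ZMod 2))}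
    (hP : ∀ i, TwoWiseIndependent (P i))
    (hlist : (1 / 2 + ε) * m ≤ m - Real.sqrt ((k : ℝ) * m)) :
    ∫ p, badErrorMass γ k ε σ p ∂systemLaw P ≤ Real.exp (-2 * ε ^ 2 * m) +
      (Fintype.card F : ℝ) ^ k *
        (((Fintype.card F : ℝ) / 2) ^ (-((1 / 2 - ε) * m - k)) * 2 ^ m) := by
  have hq : (2 : ℝ) ≤ Fintype.card F := by exact_mod_cast Fintype.one_lt_card (α := F)
  rw [integral_badErrorMass]
  exact sum_badErrors_prod_le (a := fun i x => ∫ p, coordMass σ p x ∂(P i).toMeasure)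
    (fun i x => integral_nonneg fun p => coordMass_nonneg σ p x)
    (fun i => integral_coordMass_zero σ (hP i)) (fun i => sum_integral_coordMass_le σ (P i))
    (by linarith) (fun i x hx => integral_coordMass_le σ (hP i) hx) hε γ hlist

/-- Markov's inequality for the mass of the uncorrectable errors. -/
theorem one_sub_div_le_measureReal_badErrorMass_le (γ : Fin m ↪ F) (k : ℕ) (ε : ℝ)
    (σ : F ≃ₗ[ZMod 2] (Fin n → ZMod 2)) (P : Fin m → PMF (MvPolynomial (Fin n) (ZMod 2)))
    {b δ : ℝ} (hb : ∫ p, badErrorMass γ k ε σ p ∂systemLaw P ≤ b) (hδ : 0 < δ) :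
    1 - b / δ ≤ (systemLaw P).real {p | badErrorMass γ k ε σ p ≤ δ} := by
  have h1 := mul_meas_ge_le_integral_of_nonneg
    (Eventually.of_forall fun p => badErrorMass_nonneg γ k ε σ p)
    (integrable_badErrorMass γ k ε σ P) δ
  have h2 : (systemLaw P).real {p | δ ≤ badErrorMass γ k ε σ p} ≤ b / δ := by
    rw [le_div_iff₀ hδ, mul_comm]
    exact h1.trans hb
  have h3 := measureReal_union_le (μ := systemLaw P) {p | badErrorMass γ k ε σ p ≤ δ}
    {p | δ ≤ badErrorMass γ k ε σ p}
  have h4 : {p | badErrorMass γ k ε σ p ≤ δ} ∪ {p | δ ≤ badErrorMass γ k ε σ p} = Set.univ :=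
    Set.eq_univ_of_forall fun p =>
      (le_total (badErrorMass γ k ε σ p) δ : _ ∨ _)
  rw [h4, probReal_univ] at h3
  linarith

end SystemMass

/-! ### Numerical inequalities between the parameters -/

section Parameters

theorem list_radius_bound {ε : ℝ} (hε : 0 < ε) (hε' : ε < 1 / 6) {m k : ℕ} (hm : 12 ≤ m)
    (hk : (k : ℝ) ≤ (1 / 8 - 3 / 4 * ε) * m + 1) :
    (1 / 2 + ε) * m ≤ m - Real.sqrt ((k : ℝ) * m) := by
  have hm' : (12 : ℝ) ≤ m := by exact_mod_cast hm
  have h : Real.sqrt ((k : ℝ) * m) ≤ (1 / 2 - ε) * m := by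
    rw [Real.sqrt_le_left (mul_nonneg (by linarith) (by linarith))]
    -- With `1 ≤ m/12`, this reduces to `ε/4 ≤ 1/24 + ε²`, which is where `ε < 1/6` enters.
    have h1 : (k : ℝ) ≤ (1 / 2 - ε) ^ 2 * m := by nlinarith [sq_nonneg ε]
    calc (k : ℝ) * m ≤ ((1 / 2 - ε) ^ 2 * m) * m := by gcongr
      _ = ((1 / 2 - ε) * m) ^ 2 := by ring
  linarith

theorem union_bound_le {ε : ℝ} (hε : 0 < ε) (hε' : ε < 1 / 6) {n m k : ℕ} (hn : 20 ≤ n)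
    (hm : 16 ≤ m) (hk : (k : ℝ) ≤ (1 / 8 - 3 / 4 * ε) * m + 1) :
    ((2 : ℝ) ^ n) ^ k * (((2 : ℝ) ^ n / 2) ^ (-((1 / 2 - ε) * m - k)) * 2 ^ m) ≤
      Real.exp (-2 * ε ^ 2 * m) := by
  have hm' : (16 : ℝ) ≤ m := by exact_mod_cast hm
  have hn' : (20 : ℝ) ≤ n := by exact_mod_cast hn
  have h2 : (2 : ℝ) ^ n / 2 = 2 ^ ((n : ℝ) - 1) := by
    rw [Real.rpow_sub_one (by norm_num), Real.rpow_natCast]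
  have h1 : ((2 : ℝ) ^ n) ^ k * (((2 : ℝ) ^ n / 2) ^ (-((1 / 2 - ε) * m - k)) * 2 ^ m) =
      2 ^ ((n : ℝ) * k + (((n : ℝ) - 1) * (-((1 / 2 - ε) * m - k)) + m)) := by
    rw [h2, Real.rpow_add two_pos, Real.rpow_add two_pos, Real.rpow_mul two_pos.le,
      Real.rpow_mul two_pos.le]
    simp only [Real.rpow_natCast]
  rw [h1]
  have hkn : (k : ℝ) * (2 * n) ≤ ((1 / 8 - 3 / 4 * ε) * m + 1) * (2 * n) := by gcongr
  have hk0 : (0 : ℝ) ≤ k := Nat.cast_nonneg k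
  have hnm : (20 : ℝ) * m ≤ n * m := by gcongr
  have hnm' : (n : ℝ) * 16 ≤ n * m := by gcongr
  have hεm : 0 ≤ ε * m := by positivity
  have hεnm : 0 ≤ ε * (n * m) := by positivity
  -- The left side is at most `-(1/4 + ε/2)nm + 2n + 3m/2`. Here `m ≥ 16` gives `2n ≤ nm/8`, and `n
  -- ≥ 20` makes the remaining `-nm/8` at most `-5m/2`.
  have hexp : (n : ℝ) * k + (((n : ℝ) - 1) * (-((1 / 2 - ε) * m - k)) + m) ≤ -m := by
    nlinarith
  calc (2 : ℝ) ^ ((n : ℝ) * k + (((n : ℝ) - 1) * (-((1 / 2 - ε) * m - k)) + m))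
      ≤ 2 ^ (-(m : ℝ)) := Real.rpow_le_rpow_of_exponent_le one_le_two hexp
    _ = Real.exp (Real.log 2 * (-(m : ℝ))) := Real.rpow_def_of_pos two_pos _
    _ ≤ _ := by
      rw [Real.exp_le_exp]
      have h3 := Real.log_two_gt_d9
      have h4 : 2 * ε ^ 2 ≤ Real.log 2 := by nlinarith
      nlinarith

end Parameters

/-! ### Negligible functions and the change of variable from `λ` to `n` -/

section Negligible

theorem negligible_of_eventually_le {f : ℕ → ℝ} (h0 : ∀ N, 0 ≤ f N)
    (h : ∀ c : ℕ, ∃ C : ℝ, ∀ᶠ N : ℕ in atTop, (N : ℝ) ^ c * f N ≤ C) : Negligible f := by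
  intro c
  -- The spare power of `N` turns boundedness into convergence to zero.
  obtain ⟨C, hC⟩ := h (c + 1)
  refine squeeze_zero' (Eventually.of_forall fun N => mul_nonneg (by positivity) (h0 N)) ?_
    (tendsto_const_div_atTop_nhds_zero_nat C)
  filter_upwards [hC, eventually_gt_atTop 0] with N hN hN0
  have hN0' : (0 : ℝ) < N := by exact_mod_cast hN0
  rw [le_div_iff₀ hN0']
  calc (N : ℝ) ^ c * f N * N = (N : ℝ) ^ (c + 1) * f N := by ring
    _ ≤ C := hN

variable {n m : ℕ → ℕ}

theorem eventually_le_const_mul (hn : (fun l : ℕ => (n l : ℝ)) =Θ[atTop] (fun l : ℕ => (l : ℝ))) :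
    ∃ C : ℝ, 0 < C ∧ ∀ᶠ l : ℕ in atTop, (l : ℝ) ≤ C * n l := by
  obtain ⟨C, hC, h⟩ := hn.2.exists_pos
  refine ⟨C, hC, ?_⟩
  filter_upwards [h.bound] with l hl
  simpa using hl

theorem tendsto_atTop_of_isTheta
    (hn : (fun l : ℕ => (n l : ℝ)) =Θ[atTop] (fun l : ℕ => (l : ℝ))) : Tendsto n atTop atTop := by
  obtain ⟨C, hC, h⟩ := eventually_le_const_mul hn
  rw [← tendsto_natCast_atTop_iff (R := ℝ)]
  refine tendsto_atTop_mono' _ ?_ (tendsto_natCast_atTop_atTop.atTop_div_const hC)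
  filter_upwards [h] with l hl
  rw [div_le_iff₀ hC]
  linarith

theorem tendsto_atTop_of_log_isLittleO (hn : Tendsto n atTop atTop)
    (hm : (fun l : ℕ => Real.log (n l)) =o[atTop] (fun l : ℕ => (m l : ℝ))) :
    Tendsto m atTop atTop := by
  rw [← tendsto_natCast_atTop_iff (R := ℝ)]
  refine tendsto_atTop_mono' _ ?_
    (Real.tendsto_log_atTop.comp (tendsto_natCast_atTop_atTop.comp hn))
  filter_upwards [hm.bound one_pos] with l hl
  simp only [Real.norm_eq_abs, one_mul, Nat.abs_cast] at hl
  exact (le_abs_self _).trans hl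

/-- If `log n = o(m)`, then `exp (-δ m)` decays faster than every power of `n`. -/
theorem eventually_pow_mul_exp_le (hn : Tendsto n atTop atTop)
    (hm : (fun l : ℕ => Real.log (n l)) =o[atTop] (fun l : ℕ => (m l : ℝ))) {δ : ℝ} (hδ : 0 < δ)
    (c : ℕ) : ∀ᶠ l in atTop, (n l : ℝ) ^ c * Real.exp (-δ * m l) ≤ 1 := by
  have hc : 0 < δ / (c + 1) := by positivity
  filter_upwards [hm.bound hc, hn.eventually_gt_atTop 0] with l hl hn0
  have hn0' : (0 : ℝ) < n l := by exact_mod_cast hn0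
  simp only [Real.norm_eq_abs, Nat.abs_cast] at hl
  have hl' := (le_abs_self _).trans hl
  have h1 : (n l : ℝ) ^ c = Real.exp (c * Real.log (n l)) := by
    rw [Real.exp_nat_mul, Real.exp_log hn0']
  rw [h1, ← Real.exp_add, Real.exp_le_one_iff]
  have h2 : (c : ℝ) * Real.log (n l) ≤ c * (δ / (c + 1) * m l) := by gcongr
  have h3 : (c : ℝ) * (δ / (c + 1) * m l) ≤ δ * m l := by
    have h4 : (c : ℝ) * (δ / (c + 1)) ≤ δ := by
      rw [mul_div_assoc', div_le_iff₀ (by positivity)]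
      nlinarith
    calc (c : ℝ) * (δ / (c + 1) * m l) = c * (δ / (c + 1)) * m l := by ring
      _ ≤ δ * m l := by gcongr
  linarith

/-- The largest value of `g` on the fibre of `n` over `N`. -/
def fibreSup (n : ℕ → ℕ) (g : ℕ → ℝ) (N : ℕ) : ℝ := sSup (g '' {l | n l = N})

/-- The failure bound must depend on `n l` alone, and `n` need not be injective, so the worst `l` on
each fibre is taken. Once `N` exceeds all values of `n` below `L`, the fibre over `N` lies beyond
`L`; an empty fibre has supremum `0`. -/
theorem negligible_fibreSup {g : ℕ → ℝ} (hg : ∀ l, 0 ≤ g l)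
    (h : ∀ c : ℕ, ∀ᶠ l in atTop, (n l : ℝ) ^ c * g l ≤ 1) : Negligible (fibreSup n g) := by
  refine negligible_of_eventually_le (fun N => Real.sSup_nonneg ?_) fun c => ⟨1, ?_⟩
  · rintro _ ⟨l, -, rfl⟩
    exact hg l
  obtain ⟨L, hL⟩ := eventually_atTop.1 (h c)
  filter_upwards [eventually_gt_atTop 0,
    eventually_gt_atTop ((Finset.range L).sup n)] with N hN0 hN
  have hN0' : (0 : ℝ) < (N : ℝ) ^ c := by positivity
  rw [mul_comm, ← le_div_iff₀ hN0']
  refine Real.sSup_le ?_ (by positivity)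
  rintro _ ⟨l, rfl, rfl⟩
  have hl : L ≤ l := by
    by_contra! hlt
    exact absurd (Finset.le_sup (f := n) (Finset.mem_range.2 hlt)) (not_le.2 hN)
  rw [le_div_iff₀ hN0', mul_comm]
  exact hL l hl

end Negligible

end PolySystem

end

/-! ### Assembly of the main theorem -/

theorem mainTheorem2 (ε α : ℝ) (hε_pos : 0 < ε) (hε_lt : ε < 1 / 6)
    (hα_gt : 7 / 8 + 3 / 4 * ε < α) (hα_lt : α < 1)
    (n m k : ℕ → ℕ)
    (hn : (fun l : ℕ => (n l : ℝ)) =Θ[atTop] (fun l : ℕ => (l : ℝ)))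
    (hm : (fun l : ℕ => Real.log (n l)) =o[atTop] (fun l : ℕ => (m l : ℝ)))
    (hk : ∀ l : ℕ, |(k l : ℝ) - (1 - α) * m l| < 1) :
    ∃ μ ν : ℕ → ℝ, (∀ l, μ l ∈ Set.Icc (0 : ℝ) 1) ∧ PolySystem.Negligible μ ∧
      PolySystem.Negligible ν ∧
      ∀ᶠ l : ℕ in atTop,
        ∀ (γ : Fin (m l) ↪ GaloisField 2 (n l))
          (σ : GaloisField 2 (n l) ≃ₗ[ZMod 2] (Fin (n l) → ZMod 2))
          (P : Fin (m l) → PMF (MvPolynomial (Fin (n l)) (ZMod 2))),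
          (∀ i, PolySystem.ShiftInvariant (P i)) →
          (∀ i, PolySystem.TwoWiseIndependent (P i)) →
          (∀ p : Fin (m l) → MvPolynomial (Fin (n l)) (ZMod 2),
            PolySystem.badStateMass γ (k l) ε σ p = PolySystem.badErrorMass γ (k l) ε σ p) ∧
          1 - ν (n l) ≤
            (PolySystem.systemLaw P).real
              {p | PolySystem.badErrorMass γ (k l) ε σ p ≤ μ l} := by
  open PolySystem in
  have hδ : 0 < ε ^ 2 := by positivity
  have hn_top := tendsto_atTop_of_isTheta hn
  have hm_top := tendsto_atTop_of_log_isLittleO hn_top hm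
  -- The square root of the Chernoff bound `exp(-2ε²m)`, so that Markov loses one factor `g` and
  -- keeps the other.
  set g : ℕ → ℝ := fun l => Real.exp (-ε ^ 2 * m l) with hg
  have hg0 : ∀ l, 0 < g l := fun l => Real.exp_pos _
  have hg1 : ∀ l, g l ≤ 1 := fun l => by
    rw [hg, Real.exp_le_one_iff, neg_mul, neg_nonpos]
    positivity
  have hpow : ∀ c : ℕ, ∀ᶠ l in atTop, (n l : ℝ) ^ c * g l ≤ 1 :=
    eventually_pow_mul_exp_le hn_top hm hδ
  refine ⟨fun l => min 1 (2 * g l), fibreSup n g,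
    fun l => ⟨le_min zero_le_one (by linarith [hg0 l]), min_le_left _ _⟩, ?_,
    negligible_fibreSup (fun l => (hg0 l).le) hpow, ?_⟩
  · obtain ⟨C, hC, hCn⟩ := eventually_le_const_mul hn
    refine negligible_of_eventually_le
      (fun l => le_min zero_le_one (by linarith [hg0 l])) fun c => ⟨2 * C ^ c, ?_⟩
    filter_upwards [hCn, hpow c] with l hl hgl
    calc (l : ℝ) ^ c * min 1 (2 * g l) ≤ (C * n l) ^ c * (2 * g l) := by
          have := hg0 l
          exact mul_le_mul (pow_le_pow_left₀ (Nat.cast_nonneg l) hl c) (min_le_right _ _)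
            (le_min zero_le_one (by linarith)) (by positivity)
      _ = 2 * C ^ c * ((n l : ℝ) ^ c * g l) := by ring
      _ ≤ 2 * C ^ c := mul_le_of_le_one_right (by positivity) hgl
  · filter_upwards [hn_top.eventually_ge_atTop 20, hm_top.eventually_ge_atTop 16, hpow 1]
      with l hnl hml hgl γ σ P _ hP
    refine ⟨badStateMass_eq_badErrorMass γ (k l) ε σ, ?_⟩
    have hn' : (20 : ℝ) ≤ n l := by exact_mod_cast hnl
    -- From `n l * g l ≤ 1` and `n l ≥ 20`; the truncation at `1` in `μ` is then inactive.
    have hg2 : 2 * g l ≤ 1 := by nlinarith [hg0 l]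
    have hkl : (k l : ℝ) ≤ (1 / 8 - 3 / 4 * ε) * m l + 1 := by
      have h1 := (abs_lt.1 (hk l)).2
      have h2 : (1 - α) * (m l : ℝ) ≤ (1 / 8 - 3 / 4 * ε) * m l := by
        exact mul_le_mul_of_nonneg_right (by linarith) (Nat.cast_nonneg _)
      linarith
    have hcard : (Fintype.card (GaloisField 2 (n l)) : ℝ) = 2 ^ n l := by
      rw [Fintype.card_congr σ.toEquiv]
      simp [ZMod.card]
    have hb : ∫ p, badErrorMass γ (k l) ε σ p ∂systemLaw P ≤ 2 * g l ^ 2 := by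
      have h1 := integral_badErrorMass_le γ hε_pos.le σ hP
        (list_radius_bound hε_pos hε_lt (by omega) hkl)
      rw [hcard] at h1
      have h2 := union_bound_le hε_pos hε_lt hnl hml hkl
      have h3 : Real.exp (-2 * ε ^ 2 * m l) = g l ^ 2 := by
        rw [hg, ← Real.exp_nat_mul]
        congr 1
        push_cast
        ring
      linarith
    -- Mean at most `2g²` and threshold `2g` give failure probability at most `g`.
    have hmarkov := one_sub_div_le_measureReal_badErrorMass_le γ (k l) ε σ P hb
      (by linarith [hg0 l] : 0 < 2 * g l)
    have hdiv : 2 * g l ^ 2 / (2 * g l) = g l := by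
      have := (hg0 l).ne'
      field_simp
    have hν : g l ≤ fibreSup n g (n l) :=
      le_csSup ⟨1, by rintro _ ⟨j, -, rfl⟩; exact hg1 j⟩ ⟨l, rfl, rfl⟩
    rw [hdiv] at hmarkov
    rw [min_eq_right hg2]
    linarith
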